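/- Fix $\varepsilon>0$, $\rho>0$, an integer $\tau\ge 1$, $\gamma\in\mathbb R$, $\sigma>0$, $\alpha,\beta\in(0,1)$ and $\zeta>0$ with $\zeta\alpha<1$ and $\zeta\beta<1$. For $\delta\in(0,1)$ let $t_{n,\delta}$ be the critical value of Student's $t$-distribution with $n$ degrees of freedom, i.e. the upper tail probability beyond $t_{n,\delta}$ is $\delta$. Let $n^*$ be the minimum integer $n\ge 2$ such that $t_{n-1,\zeta\alpha}+t_{n-1,\zeta\beta}\le 2\varepsilon\sqrt{n-1}$, and let $n_1<n_2<\cdots<n_s$ be the ascending arrangement of all distinct elements of $\{\lceil n^*(1+\rho)^{i-\tau}\rceil: i=1,\dots,\tau\}$; suppose that $n_1\ge 2$. Put $\theta^*=\frac{t_{n_s-1,\zeta\alpha}-t_{n_s-1,\zeta\beta}}{2\sqrt{n_s-1}}$ and, for $\ell=1,\dots,s$, \[ a_\ell=\min\{\theta^*\sqrt{n_\ell-1},\ \varepsilon\sqrt{n_\ell-1}-t_{n_\ell-1,\zeta\beta}\},\qquad b_\ell=\max\{\theta^*\sqrt{n_\ell-1},\ t_{n_\ell-1,\zeta\alpha}-\varepsilon\sqrt{n_\ell-1}\},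 \] \[ c_\ell=\frac{a_\ell}{\sqrt{n_\ell-1}},\qquad d_\ell=\frac{b_\ell}{\sqrt{n_\ell-1}},\qquad k_\ell=\sqrt{\frac{n_\ell}{n_{\ell-1}}-1}\ \ (\ell\ge 2). \] Let $X_1,X_2,\dots$ be i.i.d. normal with mean $\mu$ and variance $\sigma^2$, let $\overline X_{n}=\frac1n\sum_{i=1}^{n}X_i$, $\widehat\sigma_{n}=\sqrt{\frac{1}{n-1}\sum_{i=1}^{n}(X_i-\overline X_{n})^2}$, $\widehat T_\ell=\sqrt{n_\ell}\,(\overline X_{n_\ell}-\gamma)/\widehat\sigma_{n_\ell}$, and let $\boldsymbol D_\ell=1$ if $\widehat T_\ell\le a_\ell$, $\boldsymbol D_\ell=2$ if $\widehat T_\ell>b_\ell$, and $\boldsymbol D_\ell=0$ otherwise. The hypothesis $\mathscr H_0$ is accepted if, for some $\ell\in\{1,\dots,s\}$, $\boldsymbol D_\ell=1$ and $\boldsymbol D_i=0$ for $1\le i<\ell$. Let $U,V$ and $Y_\ell,Z_\ell$ ($\ell=2,\dots,s$) be independent random variables, where $U,V$ are standard normal and $Y_\ell,Z_\ell$ have chi-square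 distributions with $n_{\ell-1}-1$ and $n_\ell-n_{\ell-1}-1$ degrees of freedom respectively (zero degrees of freedom meaning the constant $0$). Define $\mathcal P(\theta,\zeta,\alpha,\beta)=\sum_{\ell=1}^s\mathcal P_\ell$, where $\mathcal P_1=\Pr\{\widehat T_1>a_1\}$ and, for $\ell=2,\dots,s$, if $d_\ell\ge 0$, \[ \begin{aligned}\mathcal P_\ell={}&\Pr\Big\{d_\ell\sqrt{V^2+Y_\ell+Z_\ell}<U+\sqrt{n_\ell}\,\theta\le k_\ell V+d_{\ell-1}\sqrt{\tfrac{n_\ell Y_\ell}{n_{\ell-1}}}\Big\}\\&-\Pr\Big\{d_\ell\sqrt{V^2+Y_\ell+Z_\ell}<U+\sqrt{n_\ell}\,\theta\le k_\ell V+c_{\ell-1}\sqrt{\tfrac{n_\ell Y_\ell}{n_{\ell-1}}}\Big\},\end{aligned} \] while if $d_\ell<0$, \[ \begin{aligned}\mathcal P_\ell={}&\Pr\{a_{\ell-1}<\widehat T_{\ell-1}\le b_{\ell-1}\}+\Pr\Big\{|d_\ell|\sqrt{V^2+Y_\ell+Z_\ell}\le U-\sqrt{n_\ell}\,\theta<k_\ell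 V-d_{\ell-1}\sqrt{\tfrac{n_\ell Y_\ell}{n_{\ell-1}}}\Big\}\\&-\Pr\Big\{|d_\ell|\sqrt{V^2+Y_\ell+Z_\ell}\le U-\sqrt{n_\ell}\,\theta<k_\ell V-c_{\ell-1}\sqrt{\tfrac{n_\ell Y_\ell}{n_{\ell-1}}}\Big\}.\end{aligned} \] The probabilities of events about $\widehat T_1$ and $\widehat T_{\ell-1}$ in $\mathcal P(\theta,\zeta,\alpha,\beta)$ are taken under $\mu=\theta\sigma+\gamma$; $\mathcal P(-\theta,\zeta,\beta,\alpha)$ is obtained by replacing $\theta$ by $-\theta$ and interchanging $\alpha$ and $\beta$ in all of the above definitions. Then \[ \Pr\{\text{Accept }\mathscr H_0\mid\mu=\theta\sigma+\gamma\}\ \ge\ 1-\mathcal P(\theta,\zeta,\alpha,\beta)\quad\text{for every }\theta\in(-\infty,-\varepsilon], \] \[ \Pr\{\text{Accept }\mathscr H_0\mid\mu=\theta\sigma+\gamma\}\ \le\ \mathcal P(-\theta,\zeta,\beta,\alpha)\quad\text{for every }\theta\in[\varepsilon,\infty). \] Moreover, both inequalities remain true if the first term of $\mathcal P$ is replaced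 by the smaller $\mathcal P_1=\Pr\{\widehat T_1>b_1\}$. -/

import Mathlib

open MeasureTheory ProbabilityTheory

noncomputable section

namespace TTest

/-- Density of Student's `t`-distribution with `n` degrees of freedom. -/
def studentPDF (n : ℕ) (x : ℝ) : ℝ :=
  Real.Gamma (((n : ℝ) + 1) / 2) / (Real.sqrt (n * Real.pi) * Real.Gamma ((n : ℝ) / 2)) *
    (1 + x ^ 2 / n) ^ (-(((n : ℝ) + 1) / 2))

/-- Upper critical value `t_{n,δ}`: the solution `t` of `∫_t^∞ studentPDF n = δ`. For `n ≥ 1` and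
`0 < δ < 1` the solution exists and is unique, so that the set below is a singleton. -/
def tCrit (n : ℕ) (δ : ℝ) : ℝ :=
  sInf {t : ℝ | ∫ x in Set.Ioi t, studentPDF n x = δ}

/-- Chi-square distribution with `k` degrees of freedom: the law of the sum of the squares of `k`
independent standard normal variables (the Dirac mass at `0` if `k = 0`). -/
def chiSquare (k : ℕ) : Measure ℝ :=
  (Measure.pi (fun _ : Fin k => gaussianReal 0 1)).map (fun x => ∑ i, x i ^ 2)

/-- `n^*`: the least `n` (with `n - 1 ≥ 1` degrees of freedom) such that
`t_{n-1,ζα} + t_{n-1,ζβ} ≤ 2 ε √(n-1)`. -/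
def nStar (ε ζ α β : ℝ) : ℕ :=
  sInf {n : ℕ | 2 ≤ n ∧
    tCrit (n - 1) (ζ * α) + tCrit (n - 1) (ζ * β) ≤ 2 * ε * Real.sqrt ((n : ℝ) - 1)}

/-- The set `{⌈n^* (1+ρ)^(i-τ)⌉ : i = 1, …, τ}`. -/
def sizeSet (ε ρ : ℝ) (τ : ℕ) (ζ α β : ℝ) : Finset ℕ :=
  (Finset.Icc 1 τ).image
    (fun i : ℕ => ⌈(nStar ε ζ α β : ℝ) * (1 + ρ) ^ ((i : ℤ) - (τ : ℤ))⌉₊)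

/-- Number `s` of stages. -/
def numStages (ε ρ : ℝ) (τ : ℕ) (ζ α β : ℝ) : ℕ := (sizeSet ε ρ τ ζ α β).card

/-- Sample size `n_ℓ` of stage `ℓ ∈ {1, …, s}`: the `ℓ`-th smallest element of the set of sizes
(`Nat.nth` counts from `0`). -/
def sampleSize (ε ρ : ℝ) (τ : ℕ) (ζ α β : ℝ) (l : ℕ) : ℕ :=
  Nat.nth (fun n => n ∈ sizeSet ε ρ τ ζ α β) (l - 1)

/-- `θ^*`. -/
def thetaStar (ε ρ : ℝ) (τ : ℕ) (ζ α β : ℝ) : ℝ :=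
  let ns := sampleSize ε ρ τ ζ α β (numStages ε ρ τ ζ α β)
  (tCrit (ns - 1) (ζ * α) - tCrit (ns - 1) (ζ * β)) / (2 * Real.sqrt ((ns : ℝ) - 1))

/-- Acceptance threshold `a_ℓ`. -/
def aThr (ε ρ : ℝ) (τ : ℕ) (ζ α β : ℝ) (l : ℕ) : ℝ :=
  let n := sampleSize ε ρ τ ζ α β l
  min (thetaStar ε ρ τ ζ α β * Real.sqrt ((n : ℝ) - 1))
    (ε * Real.sqrt ((n : ℝ) - 1) - tCrit (n - 1) (ζ * β))

/-- Rejection threshold `b_ℓ`. -/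
def bThr (ε ρ : ℝ) (τ : ℕ) (ζ α β : ℝ) (l : ℕ) : ℝ :=
  let n := sampleSize ε ρ τ ζ α β l
  max (thetaStar ε ρ τ ζ α β * Real.sqrt ((n : ℝ) - 1))
    (tCrit (n - 1) (ζ * α) - ε * Real.sqrt ((n : ℝ) - 1))

/-- Sample mean of the first `n` observations (`x i` is the observation number `i + 1`). -/
def sampleMean (n : ℕ) (x : ℕ → ℝ) : ℝ := (∑ i ∈ Finset.range n, x i) / n

/-- Sample standard deviation of the first `n` observations. -/
def sampleSD (n : ℕ) (x : ℕ → ℝ) : ℝ :=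
  Real.sqrt ((∑ i ∈ Finset.range n, (x i - sampleMean n x) ^ 2) / ((n : ℝ) - 1))

/-- The `t`-statistic `√n (X̄_n - γ) / σ̂_n`. -/
def tStat (γ : ℝ) (n : ℕ) (x : ℕ → ℝ) : ℝ :=
  Real.sqrt n * (sampleMean n x - γ) / sampleSD n x

/-- The statistic `T̂_ℓ` of stage `ℓ`. -/
def stageStat (ε ρ : ℝ) (τ : ℕ) (γ ζ α β : ℝ) (l : ℕ) (x : ℕ → ℝ) : ℝ :=
  tStat γ (sampleSize ε ρ τ ζ α β l) x

/-- The decision variable `D_ℓ`: `1` accept, `2` reject, `0` continue. -/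
def decision (ε ρ : ℝ) (τ : ℕ) (γ ζ α β : ℝ) (l : ℕ) (x : ℕ → ℝ) : ℕ :=
  if stageStat ε ρ τ γ ζ α β l x ≤ aThr ε ρ τ ζ α β l then 1
  else if bThr ε ρ τ ζ α β l < stageStat ε ρ τ γ ζ α β l x then 2
  else 0

/-- The null hypothesis is accepted (at some stage) on the sample path `x`. -/
def AcceptsH0 (ε ρ : ℝ) (τ : ℕ) (γ ζ α β : ℝ) (x : ℕ → ℝ) : Prop :=
  ∃ l, 1 ≤ l ∧ l ≤ numStages ε ρ τ ζ α β ∧ decision ε ρ τ γ ζ α β l x = 1 ∧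
    ∀ i, 1 ≤ i → i < l → decision ε ρ τ γ ζ α β i x = 0

/-- Law of an infinite i.i.d. sample from `N(μ, σ²)`. -/
def sampleLaw (μ σ : ℝ) : Measure (ℕ → ℝ) :=
  Measure.infinitePi (fun _ : ℕ => gaussianReal μ (Real.toNNReal (σ ^ 2)))

/-- Joint law of the independent variables `(U, V, Y, Z)` belonging to consecutive sample sizes
`m < n`: two standard normals and chi-squares with `m - 1` and `n - m - 1` degrees of freedom. -/
def auxLaw (m n : ℕ) : Measure (ℝ × ℝ × ℝ × ℝ) :=
  (gaussianReal 0 1).prod ((gaussianReal 0 1).prod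
    ((chiSquare (m - 1)).prod (chiSquare (n - m - 1))))

/-- `c_ℓ = a_ℓ / √(n_ℓ - 1)`. -/
def cThr (ε ρ : ℝ) (τ : ℕ) (ζ α β : ℝ) (l : ℕ) : ℝ :=
  aThr ε ρ τ ζ α β l / Real.sqrt ((sampleSize ε ρ τ ζ α β l : ℝ) - 1)

/-- `d_ℓ = b_ℓ / √(n_ℓ - 1)`. -/
def dThr (ε ρ : ℝ) (τ : ℕ) (ζ α β : ℝ) (l : ℕ) : ℝ :=
  bThr ε ρ τ ζ α β l / Real.sqrt ((sampleSize ε ρ τ ζ α β l : ℝ) - 1)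

/-- `k_ℓ = √(n_ℓ / n_{ℓ-1} - 1)`. -/
def kCoef (ε ρ : ℝ) (τ : ℕ) (ζ α β : ℝ) (l : ℕ) : ℝ :=
  Real.sqrt ((sampleSize ε ρ τ ζ α β l : ℝ) / (sampleSize ε ρ τ ζ α β (l - 1) : ℝ) - 1)

/-- `Pr {d_ℓ √(V² + Y + Z) < U + √n_ℓ θ ≤ k_ℓ V + q √(n_ℓ Y / n_{ℓ-1})}`. -/
def probNonneg (ε ρ : ℝ) (τ : ℕ) (θ ζ α β : ℝ) (l : ℕ) (q : ℝ) : ℝ :=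
  let m := sampleSize ε ρ τ ζ α β (l - 1)
  let n := sampleSize ε ρ τ ζ α β l
  (auxLaw m n).real {(u, v, y, z) : ℝ × ℝ × ℝ × ℝ |
    dThr ε ρ τ ζ α β l * Real.sqrt (v ^ 2 + y + z) < u + Real.sqrt n * θ ∧
    u + Real.sqrt n * θ ≤ kCoef ε ρ τ ζ α β l * v + q * Real.sqrt ((n : ℝ) * y / m)}

/-- `Pr {|d_ℓ| √(V² + Y + Z) ≤ U - √n_ℓ θ < k_ℓ V - q √(n_ℓ Y / n_{ℓ-1})}`. -/
def probNeg (ε ρ : ℝ) (τ : ℕ) (θ ζ α β : ℝ) (l : ℕ) (q : ℝ) : ℝ :=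
  let m := sampleSize ε ρ τ ζ α β (l - 1)
  let n := sampleSize ε ρ τ ζ α β l
  (auxLaw m n).real {(u, v, y, z) : ℝ × ℝ × ℝ × ℝ |
    |dThr ε ρ τ ζ α β l| * Real.sqrt (v ^ 2 + y + z) ≤ u - Real.sqrt n * θ ∧
    u - Real.sqrt n * θ < kCoef ε ρ τ ζ α β l * v - q * Real.sqrt ((n : ℝ) * y / m)}

/-- The term `𝒫_ℓ`, `ℓ ≥ 2`. The probability about `T̂_{ℓ-1}` is taken under `μ = θσ + γ`. -/
def stageTerm (ε ρ : ℝ) (τ : ℕ) (γ σ θ ζ α β : ℝ) (l : ℕ) : ℝ :=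
  if 0 ≤ dThr ε ρ τ ζ α β l then
    probNonneg ε ρ τ θ ζ α β l (dThr ε ρ τ ζ α β (l - 1)) -
      probNonneg ε ρ τ θ ζ α β l (cThr ε ρ τ ζ α β (l - 1))
  else
    (sampleLaw (θ * σ + γ) σ).real {x |
        aThr ε ρ τ ζ α β (l - 1) < stageStat ε ρ τ γ ζ α β (l - 1) x ∧
        stageStat ε ρ τ γ ζ α β (l - 1) x ≤ bThr ε ρ τ ζ α β (l - 1)} +
      probNeg ε ρ τ θ ζ α β l (dThr ε ρ τ ζ α β (l - 1)) -
      probNeg ε ρ τ θ ζ α β l (cThr ε ρ τ ζ α β (l - 1))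

/-- `Pr {T̂_1 > q}` under `μ = θσ + γ`. -/
def firstTerm (ε ρ : ℝ) (τ : ℕ) (γ σ θ ζ α β q : ℝ) : ℝ :=
  (sampleLaw (θ * σ + γ) σ).real {x | q < stageStat ε ρ τ γ ζ α β 1 x}

/-- `𝒫(θ, ζ, α, β) = ∑_{ℓ=1}^s 𝒫_ℓ` with `𝒫_1 = Pr {T̂_1 > a_1}`. -/
def ocBound (ε ρ : ℝ) (τ : ℕ) (γ σ θ ζ α β : ℝ) : ℝ :=
  firstTerm ε ρ τ γ σ θ ζ α β (aThr ε ρ τ ζ α β 1) +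
    ∑ l ∈ Finset.Icc 2 (numStages ε ρ τ ζ α β), stageTerm ε ρ τ γ σ θ ζ α β l

/-- The same sum with the smaller first term `𝒫_1 = Pr {T̂_1 > b_1}`. -/
def ocBoundSharp (ε ρ : ℝ) (τ : ℕ) (γ σ θ ζ α β : ℝ) : ℝ :=
  firstTerm ε ρ τ γ σ θ ζ α β (bThr ε ρ τ ζ α β 1) +
    ∑ l ∈ Finset.Icc 2 (numStages ε ρ τ ζ α β), stageTerm ε ρ τ γ σ θ ζ α β l

end TTest

end

noncomputable section

namespace TTest

open scoped NNReal

/-! ### Rotations of a planar standard normal vector -/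

/-! The choice of `nStar` and `thetaStar` makes the two thresholds meet at the last stage
(`bThr_numStages_le_aThr`), so the test always stops. A path that does not accept therefore rejects
at stage 1, or at some later stage whose predecessor was undecided
(`exists_reject_of_not_acceptsH0`). The union bound over these events gives the lower bound on
acceptance, once each `stageTerm` is recognised as the probability of its event (`stageTerm_eq`).

That recognition rests on one rotation. Standardise the sample and split the first `n` observations
into blocks of sizes `m` and `n - m`. Let `U` be the scaled mean of all `n`, `V` the normalised
difference of the block means, and `Y`, `Z` the sums of squared deviations inside the blocks. These
are independent with law `auxLaw m n` (`hasLaw_auxLaw`), and the total sum of squared deviations is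
`V² + Y + Z`. Both t-statistics become functions of `(U, V, Y, Z)`
(`exists_hasLaw_auxLaw_tStat_le_iff`).

The upper bound is the lower bound for the data reflected about `γ`: reflection negates `θ` and
every t-statistic, and interchanging `α` and `β` negates and exchanges the thresholds. Almost surely
the two tests cannot both accept (`not_acceptsH0_reflect`). The bounds with the larger first term
follow from `aThr_le_bThr`. -/

lemma integral_strongDual_gaussianReal_zero (L : StrongDual ℝ ℝ) (v : ℝ≥0) :
    ∫ x, L x ∂(gaussianReal 0 v) = 0 := by
  simp [integral_continuousLinearMap_gaussianReal]

/-- The angle is the argument of `c + is`, and a centred planar Gaussian with equal variances is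
rotation invariant. In this form the first coordinate merges two scaled means and the second is
their normalised difference. -/
lemma measurePreserving_rotation {c s : ℝ} (h : c ^ 2 + s ^ 2 = 1) :
    MeasurePreserving (fun p : ℝ × ℝ => (c * p.1 + s * p.2, c * p.2 - s * p.1))
      ((gaussianReal 0 1).prod (gaussianReal 0 1))
      ((gaussianReal 0 1).prod (gaussianReal 0 1)) := by
  refine ⟨by fun_prop, ?_⟩
  have hz : ‖(⟨c, s⟩ : ℂ)‖ = 1 := by
    rw [Complex.norm_eq_sqrt_sq_add_sq, h, Real.sqrt_one]
  have hz0 : (⟨c, s⟩ : ℂ) ≠ 0 := by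
    intro h0
    rw [h0] at hz
    simp at hz
  have hc : Real.cos (Complex.arg ⟨c, s⟩) = c := by simp [Complex.cos_arg hz0, hz]
  have hs : Real.sin (Complex.arg ⟨c, s⟩) = s := by simp [Complex.sin_arg, hz]
  have key := IsGaussian.map_rotation_eq_self_of_forall_strongDual_eq_zero
    (μ := gaussianReal 0 1) (fun L => integral_strongDual_gaussianReal_zero L 1)
    (Complex.arg ⟨c, s⟩)
  convert! key using 2
  ext p
  · simp [ContinuousLinearMap.rotation_apply, hc, hs]
  · simp only [ContinuousLinearMap.rotation_apply, hc, hs, smul_eq_mul]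
    ring

/-! ### Chi-square distributions -/

lemma measurable_sum_sq (k : ℕ) : Measurable fun x : Fin k → ℝ => ∑ i, x i ^ 2 := by fun_prop

instance isProbabilityMeasure_chiSquare (k : ℕ) : IsProbabilityMeasure (chiSquare k) :=
  Measure.isProbabilityMeasure_map (measurable_sum_sq k).aemeasurable

lemma chiSquare_zero : chiSquare 0 = Measure.dirac 0 := by
  simp [chiSquare]

lemma chiSquare_succ (k : ℕ) :
    ((chiSquare k).prod (gaussianReal 0 1)).map (fun p : ℝ × ℝ => p.1 + p.2 ^ 2) =
      chiSquare (k + 1) := by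
  have h := (measurePreserving_piFinSuccAbove (fun _ : Fin (k + 1) => gaussianReal 0 1) 0).map_eq
  have h2 : (chiSquare k).prod (gaussianReal 0 1) =
      ((Measure.pi fun _ : Fin k => gaussianReal 0 1).prod (gaussianReal 0 1)).map
        (Prod.map (fun x => ∑ i, x i ^ 2) id) := by
    rw [← Measure.map_prod_map _ _ (measurable_sum_sq k) measurable_id, Measure.map_id]
    rfl
  rw [h2, ← Measure.prod_swap, ← h, Measure.map_map measurable_swap (by fun_prop),
    Measure.map_map (by fun_prop) (by fun_prop), Measure.map_map (by fun_prop) (by fun_prop)]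
  unfold chiSquare
  congr 1
  ext x
  simp [Fin.sum_univ_succ, MeasurableEquiv.piFinSuccAbove, Fin.tail, add_comm]

/-- A single coordinate is almost surely nonzero, since the normal law has no atoms. This keeps the
denominator of the t-statistic away from `0`. -/
lemma chiSquare_pos {k : ℕ} (hk : 1 ≤ k) : ∀ᵐ y ∂(chiSquare k), 0 < y := by
  rw [chiSquare, ae_map_iff (measurable_sum_sq k).aemeasurable measurableSet_Ioi]
  have : NullSingletonClass (gaussianReal 0 1) := nullSingletonClass_gaussianReal one_ne_zero
  filter_upwards [Measure.ae_eval_ne (μ := fun _ : Fin k => gaussianReal 0 1) ⟨0, hk⟩ 0] with x hx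
  exact Finset.sum_pos' (fun i _ => sq_nonneg _) ⟨_, Finset.mem_univ _, by positivity⟩

/-! ### Independence of functions of disjoint blocks of coordinates -/

section Blocks

variable {Ω : Type*} [MeasurableSpace Ω] {P : Measure Ω}

lemma indepFun_of_dependsOn {W : ℕ → Ω → ℝ} (hW : iIndepFun W P)
    (hm : ∀ i, AEMeasurable (W i) P) {β β' : Type*} [MeasurableSpace β] [MeasurableSpace β']
    {f : (ℕ → ℝ) → β} {g : (ℕ → ℝ) → β'} (hf : Measurable f) (hg : Measurable g)
    {S T : Finset ℕ} (hST : Disjoint S T)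
    (hfS : ∀ x y : ℕ → ℝ, (∀ i ∈ S, x i = y i) → f x = f y)
    (hgT : ∀ x y : ℕ → ℝ, (∀ i ∈ T, x i = y i) → g x = g y) :
    IndepFun (fun ω => f fun i => W i ω) (fun ω => g fun i => W i ω) P := by
  classical
  -- Padding with zeros outside `R` turns `f` and `g` into functions of finitely many coordinates,
  -- where independence of disjoint finite families applies.
  let e (R : Finset ℕ) (v : R → ℝ) (i : ℕ) : ℝ := if h : i ∈ R then v ⟨i, h⟩ else 0
  have he (R : Finset ℕ) : Measurable (e R) := by
    refine measurable_pi_iff.2 fun i => ?_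
    by_cases h : i ∈ R
    · simpa [e, h] using measurable_pi_apply (⟨i, h⟩ : R)
    · simp [e, h]
  have h := (hW.indepFun_finset₀ S T hST hm).comp (hf.comp (he S)) (hg.comp (he T))
  have h1 : (f ∘ e S) ∘ (fun a (i : S) => W i a) = fun ω => f fun i => W i ω := by
    ext1 ω
    exact hfS _ _ fun i hi => by simp [e, hi]
  have h2 : (g ∘ e T) ∘ (fun a (i : T) => W i a) = fun ω => g fun i => W i ω := by
    ext1 ω
    exact hgT _ _ fun i hi => by simp [e, hi]
  rwa [h1, h2] at h

/-! ### Sample mean and squared deviations: merging blocks, joint laws -/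

/-- Sum of the squared deviations of the first `n` observations from their mean. -/
def sumSqDev (n : ℕ) (x : ℕ → ℝ) : ℝ := ∑ i ∈ Finset.range n, (x i - sampleMean n x) ^ 2

/-- Sample mean, scaled to have the variance of one observation. -/
def scaledMean (n : ℕ) (x : ℕ → ℝ) : ℝ := Real.sqrt n * sampleMean n x

lemma measurable_sampleMean (n : ℕ) : Measurable (sampleMean n) := by
  unfold sampleMean; fun_prop

lemma measurable_scaledMean (n : ℕ) : Measurable (scaledMean n) :=
  (measurable_sampleMean n).const_mul _

lemma measurable_sumSqDev (n : ℕ) : Measurable (sumSqDev n) := by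
  have := measurable_sampleMean n
  unfold sumSqDev; fun_prop

lemma sampleMean_congr {n : ℕ} {x y : ℕ → ℝ} (h : ∀ i ∈ Finset.range n, x i = y i) :
    sampleMean n x = sampleMean n y := by
  unfold sampleMean
  rw [Finset.sum_congr rfl h]

lemma scaledMean_congr {n : ℕ} {x y : ℕ → ℝ} (h : ∀ i ∈ Finset.range n, x i = y i) :
    scaledMean n x = scaledMean n y := by
  rw [scaledMean, scaledMean, sampleMean_congr h]

lemma sumSqDev_congr {n : ℕ} {x y : ℕ → ℝ} (h : ∀ i ∈ Finset.range n, x i = y i) :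
    sumSqDev n x = sumSqDev n y := by
  unfold sumSqDev
  exact Finset.sum_congr rfl fun i hi => by rw [h i hi, sampleMean_congr h]

lemma sum_eq_mul_sampleMean {n : ℕ} (hn : 1 ≤ n) (x : ℕ → ℝ) :
    ∑ i ∈ Finset.range n, x i = n * sampleMean n x := by
  have : (n : ℝ) ≠ 0 := by positivity
  unfold sampleMean
  field_simp

lemma sumSqDev_eq {n : ℕ} (hn : 1 ≤ n) (x : ℕ → ℝ) :
    sumSqDev n x = ∑ i ∈ Finset.range n, x i ^ 2 - n * sampleMean n x ^ 2 := by
  have h := sum_eq_mul_sampleMean hn x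
  simp only [sumSqDev, sub_sq, Finset.sum_add_distrib, Finset.sum_sub_distrib, Finset.sum_const,
    Finset.card_range, nsmul_eq_mul, ← Finset.sum_mul, ← Finset.mul_sum]
  rw [h]
  ring

/-- The mean of two consecutive blocks. -/
lemma sampleMean_add {m k : ℕ} (hm : 1 ≤ m) (hk : 1 ≤ k) (x : ℕ → ℝ) :
    ((m : ℝ) + k) * sampleMean (m + k) x =
      m * sampleMean m x + k * sampleMean k (fun i => x (m + i)) := by
  have h := sum_eq_mul_sampleMean (n := m + k) (by omega) x
  rw [Finset.sum_range_add, sum_eq_mul_sampleMean hm, sum_eq_mul_sampleMean hk] at h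
  rw [h]
  push_cast
  ring

/-- Coefficients of the rotation that merges two blocks. -/
lemma sq_sqrt_div_add {m k : ℕ} (hm : 1 ≤ m) :
    (Real.sqrt m / Real.sqrt ((m : ℝ) + k)) ^ 2 + (Real.sqrt k / Real.sqrt ((m : ℝ) + k)) ^ 2
      = 1 := by
  have : (0 : ℝ) < m := by positivity
  rw [div_pow, div_pow, Real.sq_sqrt (by positivity), Real.sq_sqrt (by positivity),
    Real.sq_sqrt (by positivity)]
  field_simp

lemma scaledMean_add {m k : ℕ} (hm : 1 ≤ m) (hk : 1 ≤ k) (x : ℕ → ℝ) :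
    scaledMean (m + k) x = Real.sqrt m / Real.sqrt ((m : ℝ) + k) * scaledMean m x +
      Real.sqrt k / Real.sqrt ((m : ℝ) + k) * scaledMean k (fun i => x (m + i)) := by
  have hm0 : (0 : ℝ) < m := by positivity
  have h := sampleMean_add hm hk x
  have h1 : Real.sqrt m ^ 2 = m := Real.sq_sqrt (by positivity)
  have h2 : Real.sqrt k ^ 2 = k := Real.sq_sqrt (by positivity)
  have h3 : Real.sqrt ((m : ℝ) + k) ^ 2 = m + k := Real.sq_sqrt (by positivity)
  have h4 : Real.sqrt ((m : ℝ) + k) ≠ 0 := by positivity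
  unfold scaledMean
  push_cast
  field_simp
  rw [h1, h2, h3, h]

/-- The between-block part of the variance is the square of the second rotated coordinate; the first
one is the merged scaled mean of `scaledMean_add`. -/
lemma sumSqDev_add {m k : ℕ} (hm : 1 ≤ m) (hk : 1 ≤ k) (x : ℕ → ℝ) :
    sumSqDev (m + k) x = (Real.sqrt m / Real.sqrt ((m : ℝ) + k) * scaledMean k (fun i => x (m + i))
        - Real.sqrt k / Real.sqrt ((m : ℝ) + k) * scaledMean m x) ^ 2 +
      sumSqDev m x + sumSqDev k (fun i => x (m + i)) := by
  have hrot : ∀ c s a b : ℝ, c ^ 2 + s ^ 2 = 1 →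
      (c * b - s * a) ^ 2 = a ^ 2 + b ^ 2 - (c * a + s * b) ^ 2 := by
    intro c s a b h
    linear_combination (a ^ 2 + b ^ 2) * h
  rw [hrot _ _ _ _ (sq_sqrt_div_add hm), ← scaledMean_add hm hk, sumSqDev_eq hm, sumSqDev_eq hk,
    sumSqDev_eq (by omega : 1 ≤ m + k), Finset.sum_range_add]
  simp only [scaledMean, mul_pow, Real.sq_sqrt (Nat.cast_nonneg _)]
  ring

/-- For a standard normal sample, the scaled mean and the sum of the squared deviations are
independent, standard normal and chi-square respectively. -/
lemma hasLaw_scaledMean_sumSqDev [IsProbabilityMeasure P] {W : ℕ → Ω → ℝ} (hW : iIndepFun W P)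
    (hlaw : ∀ i, HasLaw (W i) (gaussianReal 0 1) P) {n : ℕ} (hn : 1 ≤ n) :
    HasLaw (fun ω => (scaledMean n fun i => W i ω, sumSqDev n fun i => W i ω))
      ((gaussianReal 0 1).prod (chiSquare (n - 1))) P := by
  -- One observation is appended at a time. Rotating it with the old scaled mean gives the new
  -- scaled mean and an independent standard normal, whose square raises the chi-square by one
  -- degree of freedom (`chiSquare_succ`).
  induction n, hn using Nat.le_induction with
  | base =>
    have h1 : (fun ω => (scaledMean 1 fun i => W i ω, sumSqDev 1 fun i => W i ω)) =
        fun ω => (W 0 ω, (0 : ℝ)) := by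
      ext ω <;> simp [scaledMean, sumSqDev, sampleMean]
    rw [h1, Nat.sub_self, chiSquare_zero]
    refine IndepFun.hasLaw_prod (hlaw 0) (hasLaw_dirac_of_ae_eq (Filter.EventuallyEq.refl _ _)) ?_
    exact (indepFun_const_right _ _)
  | succ k hk ih =>
    obtain ⟨j, rfl⟩ : ∃ j, k = j + 1 := ⟨k - 1, by omega⟩
    simp only [Nat.add_sub_cancel] at ih ⊢
    set c := Real.sqrt (j + 1 : ℕ) / Real.sqrt ((j + 1 : ℕ) + (1 : ℕ))
    set s := Real.sqrt (1 : ℕ) / Real.sqrt ((j + 1 : ℕ) + (1 : ℕ))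
    have hcs : c ^ 2 + s ^ 2 = 1 := sq_sqrt_div_add (k := 1) (by omega)
    have hind : IndepFun (fun ω => (scaledMean (j + 1) fun i => W i ω,
        sumSqDev (j + 1) fun i => W i ω)) (W (j + 1)) P :=
      indepFun_of_dependsOn (f := fun x => (scaledMean (j + 1) x, sumSqDev (j + 1) x))
        (g := fun x => x (j + 1)) (S := Finset.range (j + 1)) (T := {j + 1}) hW
        (fun i => (hlaw i).aemeasurable)
        ((measurable_scaledMean _).prodMk (measurable_sumSqDev _)) (measurable_pi_apply _)
        (by simp)
        (fun x y h => by rw [scaledMean_congr h, sumSqDev_congr h])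
        (fun x y h => h _ (by simp))
    have hjoint := hind.hasLaw_prod ih (hlaw (j + 1))
    have hperm : MeasurePreserving (fun p : (ℝ × ℝ) × ℝ => ((p.1.1, p.2), p.1.2))
        (((gaussianReal 0 1).prod (chiSquare j)).prod (gaussianReal 0 1))
        (((gaussianReal 0 1).prod (gaussianReal 0 1)).prod (chiSquare j)) := by
      have h1 := measurePreserving_prodAssoc (gaussianReal 0 1) (chiSquare j) (gaussianReal 0 1)
      have h2 := (MeasurePreserving.id (gaussianReal 0 1)).prod
        (Measure.measurePreserving_swap (μ := chiSquare j) (ν := gaussianReal 0 1))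
      have h3 := (measurePreserving_prodAssoc (gaussianReal 0 1) (gaussianReal 0 1)
        (chiSquare j)).symm
      exact h3.comp (h2.comp h1)
    have hrot := ((measurePreserving_rotation hcs).prod (MeasurePreserving.id (chiSquare j)))
    have hmerge : MeasurePreserving (fun p : (ℝ × ℝ) × ℝ => (p.1.1, p.2 + p.1.2 ^ 2))
        (((gaussianReal 0 1).prod (gaussianReal 0 1)).prod (chiSquare j))
        ((gaussianReal 0 1).prod (chiSquare (j + 1))) := by
      have h1 := measurePreserving_prodAssoc (gaussianReal 0 1) (gaussianReal 0 1) (chiSquare j)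
      have h2 : MeasurePreserving (fun p : ℝ × ℝ => p.2 + p.1 ^ 2)
          ((gaussianReal 0 1).prod (chiSquare j)) (chiSquare (j + 1)) := by
        have h3 : MeasurePreserving (fun p : ℝ × ℝ => p.1 + p.2 ^ 2)
          ((chiSquare j).prod (gaussianReal 0 1)) (chiSquare (j + 1)) :=
            ⟨by fun_prop, chiSquare_succ j⟩
        exact h3.comp Measure.measurePreserving_swap
      exact ((MeasurePreserving.id _).prod h2).comp h1
    have := ((hmerge.comp (hrot.comp hperm)).comp_hasLaw hjoint)
    convert this using 1
    ext ω
    · simp only [Function.comp, Prod.map, id]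
      rw [scaledMean_add (m := j + 1) (k := 1) (by omega) le_rfl]
      simp [c, s, scaledMean, sampleMean]
    · simp only [Function.comp, Prod.map, id]
      rw [sumSqDev_add (m := j + 1) (k := 1) (by omega) le_rfl]
      simp [c, s, scaledMean, sampleMean, sumSqDev]
      ring

/-- Joint law of the scaled mean, the normalised difference of the block means, and the sums of
squared deviations of two consecutive blocks of a standard normal sample. -/
lemma hasLaw_auxLaw [IsProbabilityMeasure P] {W : ℕ → Ω → ℝ} (hW : iIndepFun W P)
    (hlaw : ∀ i, HasLaw (W i) (gaussianReal 0 1) P) {m k : ℕ} (hm : 1 ≤ m) (hk : 1 ≤ k) :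
    HasLaw (fun ω => (scaledMean (m + k) fun i => W i ω,
        Real.sqrt m / Real.sqrt ((m : ℝ) + k) * scaledMean k (fun i => W (m + i) ω) -
          Real.sqrt k / Real.sqrt ((m : ℝ) + k) * scaledMean m (fun i => W i ω),
        sumSqDev m fun i => W i ω, sumSqDev k fun i => W (m + i) ω))
      (auxLaw m (m + k)) P := by
  have h1 := hasLaw_scaledMean_sumSqDev hW hlaw hm
  have h2 := hasLaw_scaledMean_sumSqDev (W := fun i => W (m + i))
    (hW.precomp (add_right_injective m)) (fun i => hlaw (m + i)) hk
  have hind := indepFun_of_dependsOn (f := fun x => (scaledMean m x, sumSqDev m x))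
    (g := fun x => (scaledMean k (fun i => x (m + i)), sumSqDev k (fun i => x (m + i))))
    (S := Finset.range m) (T := Finset.Ico m (m + k)) hW (fun i => (hlaw i).aemeasurable)
    ((measurable_scaledMean _).prodMk (measurable_sumSqDev _))
    (by
      have h : Measurable fun (x : ℕ → ℝ) (i : ℕ) => x (m + i) := by fun_prop
      exact ((measurable_scaledMean _).comp h).prodMk ((measurable_sumSqDev _).comp h))
    (by rw [Finset.disjoint_left]; intro i; simp; omega)
    (fun x y h => by rw [scaledMean_congr h, sumSqDev_congr h])
    (fun x y h => by
      have h' : ∀ i ∈ Finset.range k, x (m + i) = y (m + i) := fun i hi => h _ (by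
        simp at hi ⊢; omega)
      rw [scaledMean_congr (x := fun i => x (m + i)) h',
        sumSqDev_congr (x := fun i => x (m + i)) h'])
  have hjoint := hind.hasLaw_prod h1 h2
  have hcs := sq_sqrt_div_add (k := k) hm
  set c := Real.sqrt m / Real.sqrt ((m : ℝ) + k)
  set s := Real.sqrt k / Real.sqrt ((m : ℝ) + k)
  set G := gaussianReal 0 1
  have hperm : MeasurePreserving (fun p : (ℝ × ℝ) × (ℝ × ℝ) => ((p.1.1, p.2.1), (p.1.2, p.2.2)))
      ((G.prod (chiSquare (m - 1))).prod (G.prod (chiSquare (k - 1))))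
      ((G.prod G).prod ((chiSquare (m - 1)).prod (chiSquare (k - 1)))) := by
    have e1 := measurePreserving_prodAssoc G (chiSquare (m - 1)) (G.prod (chiSquare (k - 1)))
    have e2 := (MeasurePreserving.id G).prod
      (measurePreserving_prodAssoc (chiSquare (m - 1)) G (chiSquare (k - 1))).symm
    have e3 := (MeasurePreserving.id G).prod
      ((Measure.measurePreserving_swap (μ := chiSquare (m - 1)) (ν := G)).prod
        (MeasurePreserving.id (chiSquare (k - 1))))
    have e4 := (MeasurePreserving.id G).prod
      (measurePreserving_prodAssoc G (chiSquare (m - 1)) (chiSquare (k - 1)))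
    have e5 := (measurePreserving_prodAssoc G G
      ((chiSquare (m - 1)).prod (chiSquare (k - 1)))).symm
    exact e5.comp (e4.comp (e3.comp (e2.comp e1)))
  -- The rotation mixes only the two scaled means and leaves the chi-square coordinates alone, so
  -- all four variables come out independent.
  have hrot := (measurePreserving_rotation hcs).prod
    (MeasurePreserving.id ((chiSquare (m - 1)).prod (chiSquare (k - 1))))
  have hassoc := measurePreserving_prodAssoc G G ((chiSquare (m - 1)).prod (chiSquare (k - 1)))
  have := (hassoc.comp (hrot.comp hperm)).comp_hasLaw hjoint
  rw [auxLaw, Nat.add_sub_cancel_left]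
  convert this using 1
  ext ω
  · simp [Function.comp, Prod.map, scaledMean_add hm hk, c, s, MeasurableEquiv.prodAssoc]
  · simp [Function.comp, Prod.map, c, s, MeasurableEquiv.prodAssoc]
  · simp [Function.comp, Prod.map, MeasurableEquiv.prodAssoc]
  · simp [Function.comp, Prod.map, MeasurableEquiv.prodAssoc]

end Blocks

/-! ### The `t`-statistic of a normal sample -/

instance isProbabilityMeasure_sampleLaw (μ σ : ℝ) : IsProbabilityMeasure (sampleLaw μ σ) := by
  unfold sampleLaw; infer_instance

lemma measurable_sampleSD (n : ℕ) : Measurable (sampleSD n) := by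
  have := measurable_sampleMean n
  unfold sampleSD; fun_prop

lemma measurable_tStat (γ : ℝ) (n : ℕ) : Measurable (tStat γ n) := by
  have := measurable_sampleMean n
  have := measurable_sampleSD n
  unfold tStat; fun_prop

lemma iIndepFun_standardize (μ σ : ℝ) :
    iIndepFun (fun (i : ℕ) (x : ℕ → ℝ) => (x i - μ) / σ) (sampleLaw μ σ) :=
  iIndepFun_infinitePi (X := fun _ (y : ℝ) => (y - μ) / σ) (fun _ => by fun_prop)

lemma hasLaw_standardize (μ : ℝ) {σ : ℝ} (hσ : 0 < σ) (i : ℕ) :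
    HasLaw (fun x : ℕ → ℝ => (x i - μ) / σ) (gaussianReal 0 1) (sampleLaw μ σ) := by
  have h : HasLaw (fun x : ℕ → ℝ => x i) (gaussianReal μ (Real.toNNReal (σ ^ 2)))
      (sampleLaw μ σ) := 
    (measurePreserving_eval_infinitePi
      (fun _ : ℕ => gaussianReal μ (Real.toNNReal (σ ^ 2))) i).hasLaw
  have h1 := gaussianReal_div_const (gaussianReal_sub_const h μ) σ
  convert h1 using 1
  have : σ ≠ 0 := hσ.ne'
  congr 1
  · simp
  · ext
    simp [Real.coe_toNNReal _ (sq_nonneg σ), this]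

lemma sampleMean_affine {n : ℕ} (hn : 1 ≤ n) (a b : ℝ) (w : ℕ → ℝ) :
    sampleMean n (fun i => a * w i + b) = a * sampleMean n w + b := by
  have : (n : ℝ) ≠ 0 := by positivity
  simp only [sampleMean, Finset.sum_add_distrib, ← Finset.mul_sum, Finset.sum_const,
    Finset.card_range, nsmul_eq_mul]
  field_simp

lemma sampleSD_affine {n : ℕ} (hn : 1 ≤ n) (a b : ℝ) (w : ℕ → ℝ) :
    sampleSD n (fun i => a * w i + b) = |a| * sampleSD n w := by
  have h : ∀ i, (a * w i + b - (a * sampleMean n w + b)) ^ 2 =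
      a ^ 2 * (w i - sampleMean n w) ^ 2 := fun i => by ring
  simp only [sampleSD, sampleMean_affine hn, h, ← Finset.mul_sum, mul_div_assoc]
  rw [Real.sqrt_mul (sq_nonneg a), Real.sqrt_sq_eq_abs]

lemma tStat_eq {n : ℕ} (hn : 1 ≤ n) (γ θ : ℝ) {σ : ℝ} (hσ : 0 < σ) (w : ℕ → ℝ) :
    tStat γ n (fun i => σ * w i + (θ * σ + γ)) =
      Real.sqrt ((n : ℝ) - 1) * (scaledMean n w + Real.sqrt n * θ) /
        Real.sqrt (sumSqDev n w) := by
  have hn1 : (0 : ℝ) ≤ (n : ℝ) - 1 := by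
    have : (1 : ℝ) ≤ n := by exact_mod_cast hn
    linarith
  have h : sampleSD n w = Real.sqrt (sumSqDev n w) / Real.sqrt ((n : ℝ) - 1) := by
    rw [sampleSD, Real.sqrt_div' _ hn1]; rfl
  rw [tStat, sampleMean_affine hn, sampleSD_affine hn, abs_of_pos hσ, h, scaledMean]
  have : Real.sqrt n * (σ * sampleMean n w + (θ * σ + γ) - γ) =
      σ * (Real.sqrt n * sampleMean n w + Real.sqrt n * θ) := by ring
  rw [this, mul_div_mul_left _ _ hσ.ne', div_div_eq_mul_div, mul_comm]

lemma sqrt_cast_sub_one_pos {n : ℕ} (hn : 2 ≤ n) : 0 < Real.sqrt ((n : ℝ) - 1) := by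
  have : (2 : ℝ) ≤ n := by exact_mod_cast hn
  exact Real.sqrt_pos.2 (by linarith)

lemma tStat_le_iff {n : ℕ} (hn : 2 ≤ n) (γ θ : ℝ) {σ : ℝ} (hσ : 0 < σ) {w : ℕ → ℝ}
    (hw : 0 < sumSqDev n w) (q : ℝ) :
    tStat γ n (fun i => σ * w i + (θ * σ + γ)) ≤ q ↔
      scaledMean n w + Real.sqrt n * θ ≤
        q / Real.sqrt ((n : ℝ) - 1) * Real.sqrt (sumSqDev n w) := by
  have h1 := sqrt_cast_sub_one_pos hn
  have h2 := Real.sqrt_pos.2 hw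
  rw [tStat_eq (by omega) γ θ hσ, div_le_iff₀ h2, div_mul_eq_mul_div, le_div_iff₀ h1, mul_comm]

lemma sumSqDev_standardize_pos (μ : ℝ) {σ : ℝ} (hσ : 0 < σ) {n : ℕ} (hn : 2 ≤ n) :
    ∀ᵐ x ∂(sampleLaw μ σ), 0 < sumSqDev n (fun i => (x i - μ) / σ) := by
  have h := hasLaw_scaledMean_sumSqDev (iIndepFun_standardize μ σ)
    (fun i => hasLaw_standardize μ hσ i) (n := n) (by omega)
  have hp : ∀ᵐ p ∂((gaussianReal 0 1).prod (chiSquare (n - 1))), 0 < p.2 :=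
    Measure.quasiMeasurePreserving_snd.ae (chiSquare_pos (by omega))
  have := (h.ae_iff (p := fun p => 0 < p.2) (measurableSet_setOfPred.1
    (measurableSet_lt measurable_const measurable_snd))).2 hp
  exact this

lemma unstandardize (μ : ℝ) {σ : ℝ} (hσ : 0 < σ) (x : ℕ → ℝ) :
    (fun i => σ * ((x i - μ) / σ) + μ) = x := by
  ext i
  field_simp
  ring

/-- The law of the `t`-statistic has no atoms. -/
lemma tStat_ne (γ θ : ℝ) {σ : ℝ} (hσ : 0 < σ) {n : ℕ} (hn : 2 ≤ n) (q : ℝ) :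
    ∀ᵐ x ∂(sampleLaw (θ * σ + γ) σ), tStat γ n x ≠ q := by
  set μ := θ * σ + γ
  have h := hasLaw_scaledMean_sumSqDev (iIndepFun_standardize μ σ)
    (fun i => hasLaw_standardize μ hσ i) (n := n) (by omega)
  let f : ℝ → ℝ := fun y => q / Real.sqrt ((n : ℝ) - 1) * Real.sqrt y - Real.sqrt n * θ
  have hS : MeasurableSet {p : ℝ × ℝ | p.1 = f p.2} :=
    measurableSet_eq_fun measurable_fst (by fun_prop)
  -- For a fixed sum of squares, the equation pins the normal coordinate to the single value `f y`,
  -- a null set; Fubini concludes.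
  have hp : ∀ᵐ p ∂((gaussianReal 0 1).prod (chiSquare (n - 1))), p.1 ≠ f p.2 := by
    have hatom : NullSingletonClass (gaussianReal 0 1) :=
      nullSingletonClass_gaussianReal one_ne_zero
    rw [ae_iff]
    simp only [ne_eq, not_not]
    rw [Measure.prod_apply_symm hS]
    refine lintegral_eq_zero_of_ae_eq_zero (Filter.Eventually.of_forall fun y => ?_)
    exact measure_singleton (f y)
  have h2 := (h.ae_iff (p := fun p => p.1 ≠ f p.2) (measurableSet_setOfPred.1 hS.compl)).2 hp
  filter_upwards [h2, sumSqDev_standardize_pos μ hσ hn] with x hx hpos heq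
  apply hx
  have h1 := sqrt_cast_sub_one_pos hn
  have h3 := Real.sqrt_pos.2 hpos
  rw [← unstandardize μ hσ x, tStat_eq (by omega) γ θ hσ, div_eq_iff h3.ne'] at heq
  simp only [f]
  field_simp
  linarith

/-- Two consecutive `t`-statistics can be compared with thresholds through variables with the
law `auxLaw`. -/
lemma exists_hasLaw_auxLaw_tStat_le_iff (γ θ : ℝ) {σ : ℝ} (hσ : 0 < σ) {m n : ℕ} (hm : 2 ≤ m)
    (hmn : m < n) :
    ∃ Φ : (ℕ → ℝ) → ℝ × ℝ × ℝ × ℝ, HasLaw Φ (auxLaw m n) (sampleLaw (θ * σ + γ) σ) ∧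
      ∀ᵐ x ∂(sampleLaw (θ * σ + γ) σ), ∀ q,
        (tStat γ n x ≤ q ↔ (Φ x).1 + Real.sqrt n * θ ≤ q / Real.sqrt ((n : ℝ) - 1) *
          Real.sqrt ((Φ x).2.1 ^ 2 + (Φ x).2.2.1 + (Φ x).2.2.2)) ∧
        (tStat γ m x ≤ q ↔ (Φ x).1 + Real.sqrt n * θ ≤ Real.sqrt ((n : ℝ) / m - 1) * (Φ x).2.1 +
          q / Real.sqrt ((m : ℝ) - 1) * Real.sqrt ((n : ℝ) * (Φ x).2.2.1 / m)) := by
  obtain ⟨k, rfl⟩ := Nat.exists_eq_add_of_le hmn.le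
  have hk : 1 ≤ k := by omega
  set μ := θ * σ + γ
  have h := hasLaw_auxLaw (iIndepFun_standardize μ σ) (fun i => hasLaw_standardize μ hσ i)
    (m := m) (k := k) (by omega) hk
  refine ⟨_, h, ?_⟩
  filter_upwards [sumSqDev_standardize_pos μ hσ hm,
    sumSqDev_standardize_pos μ hσ (show 2 ≤ m + k by omega)] with x hxm hxn q
  set w : ℕ → ℝ := fun i => (x i - μ) / σ with hw
  have hx : (fun i => σ * w i + μ) = x := unstandardize μ hσ x
  constructor
  · have t := tStat_le_iff (by omega) γ θ hσ hxn q
    change tStat γ (m + k) (fun i => σ * w i + μ) ≤ q ↔ _ at t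
    rwa [hx, sumSqDev_add (by omega) hk] at t
  · have t := tStat_le_iff hm γ θ hσ hxm q
    change tStat γ m (fun i => σ * w i + μ) ≤ q ↔ _ at t
    rw [hx] at t
    rw [t]
    rw [scaledMean_add (by omega) hk]
    have hm0 : (0 : ℝ) < m := by positivity
    have hr : Real.sqrt (((m + k : ℕ) : ℝ) / m - 1) = Real.sqrt k / Real.sqrt m := by
      rw [← Real.sqrt_div' _ hm0.le]
      congr 1
      push_cast
      field_simp
      ring
    have hy : Real.sqrt (((m + k : ℕ) : ℝ) * sumSqDev m w / m) =
        Real.sqrt ((m : ℝ) + k) * Real.sqrt (sumSqDev m w) / Real.sqrt m := by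
      rw [Real.sqrt_div' _ hm0.le, Real.sqrt_mul (by positivity)]
      push_cast
      rfl
    rw [hr, hy]
    push_cast
    have h1 : Real.sqrt m ^ 2 = m := Real.sq_sqrt (by positivity)
    have h2 : Real.sqrt k ^ 2 = k := Real.sq_sqrt (by positivity)
    have h3 : Real.sqrt ((m : ℝ) + k) ^ 2 = m + k := Real.sq_sqrt (by positivity)
    have h4 : 0 < Real.sqrt ((m : ℝ) + k) := by positivity
    have h5 : 0 < Real.sqrt m := by positivity
    set A := scaledMean m w
    set B := scaledMean k fun i => w (m + i)
    set M := Real.sqrt m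
    set K := Real.sqrt k
    set N := Real.sqrt ((m : ℝ) + k)
    set Q := q / Real.sqrt ((m : ℝ) - 1)
    set S := Real.sqrt (sumSqDev m w)
    have hN : N ^ 2 = M ^ 2 + K ^ 2 := by rw [h1, h2, h3]
    -- Eliminating the second block: in `U - (K / M) V` the terms in `B` cancel, and `M² + K² = N²`
    -- leaves `(N / M) A`. The stage-`m` inequality is thus only multiplied by the positive factor
    -- `N / M`.
    have key : K / M * (M / N * B - K / N * A) + Q * (N * S / M) -
        (M / N * A + K / N * B + N * θ) = N / M * (Q * S - (A + M * θ)) := by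
      field_simp
      linear_combination A * hN
    have hiff := mul_nonneg_iff_of_pos_left (b := Q * S - (A + M * θ)) (div_pos h4 h5)
    rw [← key, sub_nonneg, sub_nonneg] at hiff
    exact hiff.symm

/-- Changing the signs of `U` and `V` produces the form with `U - √n θ` and `|d|` that is used for a
negative threshold; `V` enters the radicand only through its square. -/
lemma measurePreserving_neg_neg_auxLaw (m n : ℕ) :
    MeasurePreserving (fun p : ℝ × ℝ × ℝ × ℝ => (-p.1, -p.2.1, p.2.2)) (auxLaw m n)
      (auxLaw m n) := by
  have h : MeasurePreserving (fun x : ℝ => -x) (gaussianReal 0 1) (gaussianReal 0 1) :=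
    ⟨measurable_neg, by rw [gaussianReal_map_neg, neg_zero]⟩
  exact h.prod (h.prod (MeasurePreserving.id _))

lemma auxLaw_real_upper (γ θ : ℝ) {σ : ℝ} (hσ : 0 < σ) {m n : ℕ} (hm : 2 ≤ m) (hmn : m < n)
    (e q : ℝ) :
    (auxLaw m n).real {(u, v, y, z) : ℝ × ℝ × ℝ × ℝ |
      e / Real.sqrt ((n : ℝ) - 1) * Real.sqrt (v ^ 2 + y + z) < u + Real.sqrt n * θ ∧
      u + Real.sqrt n * θ ≤ Real.sqrt ((n : ℝ) / m - 1) * v +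
        q / Real.sqrt ((m : ℝ) - 1) * Real.sqrt ((n : ℝ) * y / m)} =
    (sampleLaw (θ * σ + γ) σ).real {x | e < tStat γ n x ∧ tStat γ m x ≤ q} := by
  obtain ⟨Φ, hΦ, hiff⟩ := exists_hasLaw_auxLaw_tStat_le_iff γ θ hσ hm hmn
  rw [← hΦ.measureReal_eq]
  · refine measureReal_congr ?_
    filter_upwards [hiff] with x hx
    refine propext ?_
    have h1 := (hx e).1
    have h2 := (hx q).2
    change (_ < _ ∧ _ ≤ _) ↔ (_ < _ ∧ _ ≤ _)
    rw [h2, ← not_le (b := e), h1, not_le]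
  · change MeasurableSet ({p : ℝ × ℝ × ℝ × ℝ | e / Real.sqrt ((n : ℝ) - 1) *
        Real.sqrt (p.2.1 ^ 2 + p.2.2.1 + p.2.2.2) < p.1 + Real.sqrt n * θ} ∩
      {p | p.1 + Real.sqrt n * θ ≤ Real.sqrt ((n : ℝ) / m - 1) * p.2.1 +
        q / Real.sqrt ((m : ℝ) - 1) * Real.sqrt ((n : ℝ) * p.2.2.1 / m)})
    refine (measurableSet_lt ?_ ?_).inter (measurableSet_le ?_ ?_) <;> fun_prop

lemma auxLaw_real_lower (γ θ : ℝ) {σ : ℝ} (hσ : 0 < σ) {m n : ℕ} (hm : 2 ≤ m) (hmn : m < n)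
    {e : ℝ} (he : e / Real.sqrt ((n : ℝ) - 1) < 0) (q : ℝ) :
    (auxLaw m n).real {(u, v, y, z) : ℝ × ℝ × ℝ × ℝ |
      |e / Real.sqrt ((n : ℝ) - 1)| * Real.sqrt (v ^ 2 + y + z) ≤ u - Real.sqrt n * θ ∧
      u - Real.sqrt n * θ < Real.sqrt ((n : ℝ) / m - 1) * v -
        q / Real.sqrt ((m : ℝ) - 1) * Real.sqrt ((n : ℝ) * y / m)} =
    (sampleLaw (θ * σ + γ) σ).real {x | tStat γ n x ≤ e ∧ q < tStat γ m x} := by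
  obtain ⟨Φ, hΦ, hiff⟩ := exists_hasLaw_auxLaw_tStat_le_iff γ θ hσ hm hmn
  rw [← ((measurePreserving_neg_neg_auxLaw m n).comp_hasLaw hΦ).measureReal_eq]
  · refine measureReal_congr ?_
    filter_upwards [hiff] with x hx
    refine propext ?_
    have h1 := (hx e).1
    have h2 := (hx q).2
    change (_ ≤ _ ∧ _ < _) ↔ (_ ≤ _ ∧ _ < _)
    rw [h1, ← not_le (a := tStat γ m x), h2, not_le, abs_of_neg he]
    simp only [Function.comp, even_two, Even.neg_pow]
    constructor <;> rintro ⟨h3, h4⟩ <;> constructor <;> linarith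
  · change MeasurableSet ({p : ℝ × ℝ × ℝ × ℝ | |e / Real.sqrt ((n : ℝ) - 1)| *
        Real.sqrt (p.2.1 ^ 2 + p.2.2.1 + p.2.2.2) ≤ p.1 - Real.sqrt n * θ} ∩
      {p | p.1 - Real.sqrt n * θ < Real.sqrt ((n : ℝ) / m - 1) * p.2.1 -
        q / Real.sqrt ((m : ℝ) - 1) * Real.sqrt ((n : ℝ) * p.2.2.1 / m)})
    refine (measurableSet_le ?_ ?_).inter (measurableSet_lt ?_ ?_) <;> fun_prop

/-! ### Sample sizes and thresholds -/

lemma finite_ofPred_mem (S : Finset ℕ) : (Set.ofPred fun n => n ∈ S).Finite :=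
  S.finite_toSet

lemma card_toFinset_ofPred_mem (S : Finset ℕ) : (finite_ofPred_mem S).toFinset.card = S.card := by
  congr 1
  ext n
  simp

section Design

variable {ε ρ : ℝ} {τ : ℕ} {ζ α β : ℝ}

/-- The bound `1 ≤ i` matters: by truncated subtraction, index `0` names the same size as index `1`.
-/
lemma sampleSize_lt {i j : ℕ} (hi : 1 ≤ i) (hij : i < j) (hj : j ≤ numStages ε ρ τ ζ α β) :
    sampleSize ε ρ τ ζ α β i < sampleSize ε ρ τ ζ α β j := by
  refine Nat.nth_lt_nth_of_lt_card (finite_ofPred_mem _) (by omega) ?_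
  rw [card_toFinset_ofPred_mem]
  unfold numStages at hj
  omega

lemma two_le_sampleSize (hn1 : 2 ≤ sampleSize ε ρ τ ζ α β 1) {l : ℕ} (hl : 1 ≤ l)
    (hl' : l ≤ numStages ε ρ τ ζ α β) : 2 ≤ sampleSize ε ρ τ ζ α β l := by
  rcases hl.eq_or_lt with rfl | h
  · exact hn1
  · exact hn1.trans (sampleSize_lt le_rfl h hl').le

lemma nStar_mem_sizeSet (hτ : 1 ≤ τ) : nStar ε ζ α β ∈ sizeSet ε ρ τ ζ α β := by
  -- The index `i = τ` gives exponent `0`.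
  refine Finset.mem_image.2 ⟨τ, by simp [hτ], ?_⟩
  simp

lemma le_nStar_of_mem_sizeSet (hρ : 0 < ρ) {n : ℕ} (hn : n ∈ sizeSet ε ρ τ ζ α β) :
    n ≤ nStar ε ζ α β := by
  obtain ⟨i, hi, rfl⟩ := Finset.mem_image.1 hn
  refine Nat.ceil_le.2 (mul_le_of_le_one_right (Nat.cast_nonneg _) ?_)
  refine zpow_le_one_of_nonpos₀ (by linarith) ?_
  have := (Finset.mem_Icc.1 hi).2
  omega

lemma one_le_numStages (hτ : 1 ≤ τ) : 1 ≤ numStages ε ρ τ ζ α β :=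
  Finset.card_pos.2 ⟨_, nStar_mem_sizeSet hτ⟩

/-- The last sample size is `n^*`. -/
lemma sampleSize_numStages (hρ : 0 < ρ) (hτ : 1 ≤ τ) :
    sampleSize ε ρ τ ζ α β (numStages ε ρ τ ζ α β) = nStar ε ζ α β := by
  have hs : 1 ≤ numStages ε ρ τ ζ α β := one_le_numStages hτ
  have hcard := card_toFinset_ofPred_mem (sizeSet ε ρ τ ζ α β)
  have hlt : numStages ε ρ τ ζ α β - 1 <
      (finite_ofPred_mem (sizeSet ε ρ τ ζ α β)).toFinset.card := by
    rw [hcard]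
    unfold numStages at hs ⊢
    omega
  apply le_antisymm
  · exact le_nStar_of_mem_sizeSet hρ (Nat.nth_mem_of_lt_card (finite_ofPred_mem _) hlt)
  · obtain ⟨k, hk, hk'⟩ := Nat.exists_lt_card_finite_nth_eq
      (finite_ofPred_mem (sizeSet ε ρ τ ζ α β)) (nStar_mem_sizeSet hτ)
    rw [hcard] at hk
    rw [← hk']
    refine Nat.nth_le_nth_of_lt_card (finite_ofPred_mem _) ?_ hlt
    unfold numStages
    omega

lemma aThr_le_bThr (l : ℕ) : aThr ε ρ τ ζ α β l ≤ bThr ε ρ τ ζ α β l :=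
  (min_le_left _ _).trans (le_max_left _ _)

/-- At the last stage the two thresholds coincide, so that the test terminates. -/
lemma bThr_numStages_le_aThr (hρ : 0 < ρ) (hτ : 1 ≤ τ) (hn1 : 2 ≤ sampleSize ε ρ τ ζ α β 1) :
    bThr ε ρ τ ζ α β (numStages ε ρ τ ζ α β) ≤ aThr ε ρ τ ζ α β (numStages ε ρ τ ζ α β) := by
  have h2 := two_le_sampleSize hn1 (one_le_numStages hτ) le_rfl
  have hstar := sampleSize_numStages (ε := ε) (ζ := ζ) (α := α) (β := β) hρ hτ
  -- If no such `n` existed, `sInf ∅ = 0` would be the last sample size, against `2 ≤ n_s`. So the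
  -- infimum is attained.
  have hne : {n : ℕ | 2 ≤ n ∧
      tCrit (n - 1) (ζ * α) + tCrit (n - 1) (ζ * β) ≤
        2 * ε * Real.sqrt ((n : ℝ) - 1)}.Nonempty := by
    by_contra h
    rw [Set.not_nonempty_iff_eq_empty] at h
    rw [hstar, nStar, h, Nat.sInf_empty] at h2
    omega
  have hmem : tCrit (nStar ε ζ α β - 1) (ζ * α) + tCrit (nStar ε ζ α β - 1) (ζ * β) ≤
      2 * ε * Real.sqrt ((nStar ε ζ α β : ℝ) - 1) := (Nat.sInf_mem hne).2
  rw [hstar] at h2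
  have hpos := sqrt_cast_sub_one_pos h2
  unfold aThr bThr thetaStar
  dsimp only
  rw [hstar]
  have hmul : (tCrit (nStar ε ζ α β - 1) (ζ * α) - tCrit (nStar ε ζ α β - 1) (ζ * β)) /
      (2 * Real.sqrt ((nStar ε ζ α β : ℝ) - 1)) * Real.sqrt ((nStar ε ζ α β : ℝ) - 1) =
      (tCrit (nStar ε ζ α β - 1) (ζ * α) - tCrit (nStar ε ζ α β - 1) (ζ * β)) / 2 := by
    field_simp
  rw [hmul]
  -- Half the difference of the critical values now stands for `θ* √(n_s - 1)`; each remaining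
  -- inequality is a rearrangement of `hmem`.
  refine max_le (le_min le_rfl ?_) (le_min ?_ ?_) <;> linarith

/-! ### Interchanging the two error levels -/

lemma nStar_comm : nStar ε ζ α β = nStar ε ζ β α := by
  unfold nStar
  simp only [add_comm]

lemma sizeSet_comm : sizeSet ε ρ τ ζ α β = sizeSet ε ρ τ ζ β α := by
  unfold sizeSet
  rw [nStar_comm]

lemma numStages_comm : numStages ε ρ τ ζ α β = numStages ε ρ τ ζ β α := by
  unfold numStages
  rw [sizeSet_comm]

lemma sampleSize_comm (l : ℕ) : sampleSize ε ρ τ ζ α β l = sampleSize ε ρ τ ζ β α l := by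
  unfold sampleSize
  rw [sizeSet_comm]

lemma thetaStar_comm : thetaStar ε ρ τ ζ α β = -thetaStar ε ρ τ ζ β α := by
  unfold thetaStar
  dsimp only
  rw [numStages_comm, sampleSize_comm]
  ring

/-- Swapping the error levels negates `thetaStar`, and negation exchanges `min` and `max`. -/
lemma aThr_comm (l : ℕ) : aThr ε ρ τ ζ β α l = -bThr ε ρ τ ζ α β l := by
  unfold aThr bThr
  dsimp only
  rw [thetaStar_comm, sampleSize_comm, ← min_neg_neg, neg_mul, neg_sub]

lemma bThr_comm (l : ℕ) : bThr ε ρ τ ζ β α l = -aThr ε ρ τ ζ α β l := by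
  rw [aThr_comm (α := β) (β := α), neg_neg]

/-! ### The decisions -/

variable {γ : ℝ}

lemma decision_eq_one_iff (l : ℕ) (x : ℕ → ℝ) :
    decision ε ρ τ γ ζ α β l x = 1 ↔ stageStat ε ρ τ γ ζ α β l x ≤ aThr ε ρ τ ζ α β l := by
  unfold decision
  split_ifs <;> simp_all

lemma decision_eq_zero_iff (l : ℕ) (x : ℕ → ℝ) :
    decision ε ρ τ γ ζ α β l x = 0 ↔ aThr ε ρ τ ζ α β l < stageStat ε ρ τ γ ζ α β l x ∧
      stageStat ε ρ τ γ ζ α β l x ≤ bThr ε ρ τ ζ α β l := by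
  unfold decision
  split_ifs <;> simp_all

lemma measurable_stageStat (l : ℕ) : Measurable (stageStat ε ρ τ γ ζ α β l) :=
  measurable_tStat _ _

lemma measurableSet_decision_eq_one (l : ℕ) :
    MeasurableSet {x | decision ε ρ τ γ ζ α β l x = 1} := by
  simp only [decision_eq_one_iff]
  exact measurableSet_le (measurable_stageStat l) measurable_const

lemma measurableSet_decision_eq_zero (l : ℕ) :
    MeasurableSet {x | decision ε ρ τ γ ζ α β l x = 0} := by
  simp only [decision_eq_zero_iff]
  exact (measurableSet_lt measurable_const (measurable_stageStat l)).inter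
    (measurableSet_le (measurable_stageStat l) measurable_const)

lemma measurableSet_acceptsH0 : MeasurableSet {x | AcceptsH0 ε ρ τ γ ζ α β x} := by
  have h : {x | AcceptsH0 ε ρ τ γ ζ α β x} =
      ⋃ l, ⋃ (_ : 1 ≤ l), ⋃ (_ : l ≤ numStages ε ρ τ ζ α β),
        ({x | decision ε ρ τ γ ζ α β l x = 1} ∩
          ⋂ i, ⋂ (_ : 1 ≤ i), ⋂ (_ : i < l), {x | decision ε ρ τ γ ζ α β i x = 0}) := by
    ext x
    simp only [AcceptsH0, Set.mem_ofPred_eq, Set.mem_iUnion, Set.mem_inter_iff, Set.mem_iInter,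
      exists_prop]
  rw [h]
  exact .iUnion fun l => .iUnion fun _ => .iUnion fun _ =>
    (measurableSet_decision_eq_one l).inter <|
      .iInter fun i => .iInter fun _ => .iInter fun _ => measurableSet_decision_eq_zero i

/-- If the null hypothesis is not accepted, then it is rejected at the first stage, or at a later
stage whose predecessor was undecided. -/
lemma exists_reject_of_not_acceptsH0 (hρ : 0 < ρ) (hτ : 1 ≤ τ)
    (hn1 : 2 ≤ sampleSize ε ρ τ ζ α β 1) {x : ℕ → ℝ} (hx : ¬ AcceptsH0 ε ρ τ γ ζ α β x) :
    bThr ε ρ τ ζ α β 1 < stageStat ε ρ τ γ ζ α β 1 x ∨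
      ∃ l ∈ Finset.Icc 2 (numStages ε ρ τ ζ α β),
        (aThr ε ρ τ ζ α β (l - 1) < stageStat ε ρ τ γ ζ α β (l - 1) x ∧
          stageStat ε ρ τ γ ζ α β (l - 1) x ≤ bThr ε ρ τ ζ α β (l - 1)) ∧
        bThr ε ρ τ ζ α β l < stageStat ε ρ τ γ ζ α β l x := by
  by_contra! hcon
  obtain ⟨h1, h2⟩ := hcon
  -- With none of the listed rejections, no stage can be the first to decide: acceptance there is
  -- excluded by `hx`, rejection by `h1` and `h2`. The last stage then gives `a < T ≤ b ≤ a`.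
  have hzero : ∀ l, 1 ≤ l → l ≤ numStages ε ρ τ ζ α β → decision ε ρ τ γ ζ α β l x = 0 := by
    intro l
    induction l using Nat.strong_induction_on with
    | _ l ih =>
      intro hl hls
      have hprev : ∀ i, 1 ≤ i → i < l → decision ε ρ τ γ ζ α β i x = 0 :=
        fun i hi hil => ih i hil hi (by omega)
      rw [decision_eq_zero_iff]
      constructor
      · by_contra! hle
        exact hx ⟨l, hl, hls, (decision_eq_one_iff l x).2 hle, hprev⟩
      · rcases hl.eq_or_lt with rfl | hl2
        · exact h1
        · exact h2 l (Finset.mem_Icc.2 ⟨hl2, hls⟩)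
            ((decision_eq_zero_iff _ _).1 (hprev (l - 1) (by omega) (by omega)))
  have hlast := (decision_eq_zero_iff _ _).1 (hzero _ (one_le_numStages hτ) le_rfl)
  exact absurd (hlast.1.trans_le hlast.2) (bThr_numStages_le_aThr hρ hτ hn1).not_gt

/-! ### The bounds -/

variable {σ θ : ℝ}

/-- `𝒫_ℓ` is the probability that stage `ℓ - 1` is undecided and stage `ℓ` rejects. -/
lemma stageTerm_eq (hσ : 0 < σ) (hn1 : 2 ≤ sampleSize ε ρ τ ζ α β 1) {l : ℕ}
    (hl : l ∈ Finset.Icc 2 (numStages ε ρ τ ζ α β)) :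
    stageTerm ε ρ τ γ σ θ ζ α β l = (sampleLaw (θ * σ + γ) σ).real {x |
      (aThr ε ρ τ ζ α β (l - 1) < stageStat ε ρ τ γ ζ α β (l - 1) x ∧
        stageStat ε ρ τ γ ζ α β (l - 1) x ≤ bThr ε ρ τ ζ α β (l - 1)) ∧
      bThr ε ρ τ ζ α β l < stageStat ε ρ τ γ ζ α β l x} := by
  obtain ⟨hl2, hls⟩ := Finset.mem_Icc.1 hl
  have hm : 2 ≤ sampleSize ε ρ τ ζ α β (l - 1) := two_le_sampleSize hn1 (by omega) (by omega)
  have hmn : sampleSize ε ρ τ ζ α β (l - 1) < sampleSize ε ρ τ ζ α β l :=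
    sampleSize_lt (by omega) (by omega) hls
  have hab : aThr ε ρ τ ζ α β (l - 1) ≤ bThr ε ρ τ ζ α β (l - 1) := aThr_le_bThr _
  have hmeas := measurable_stageStat (ε := ε) (ρ := ρ) (τ := τ) (ζ := ζ) (α := α) (β := β) (γ := γ)
  set ν := sampleLaw (θ * σ + γ) σ with hν
  unfold stageTerm
  split_ifs with hd
  -- For nonnegative `d_ℓ`: the events for `q = a` and `q = b` are nested, and their difference is
  -- the event sought.
  · have hup : ∀ q, probNonneg ε ρ τ θ ζ α β l
        (q / Real.sqrt ((sampleSize ε ρ τ ζ α β (l - 1) : ℝ) - 1)) =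
        ν.real {x | bThr ε ρ τ ζ α β l < stageStat ε ρ τ γ ζ α β l x ∧
          stageStat ε ρ τ γ ζ α β (l - 1) x ≤ q} :=
      fun q => auxLaw_real_upper γ θ hσ hm hmn _ q
    rw [dThr, cThr, hup, hup, ← measureReal_sdiff]
    · congr 1
      ext x
      simp only [Set.mem_sdiff, Set.mem_ofPred_eq, not_and, not_le]
      tauto
    · exact fun x hx => ⟨hx.1, hx.2.trans hab⟩
    · exact (measurableSet_lt measurable_const (hmeas l)).inter
        (measurableSet_le (hmeas (l - 1)) measurable_const)
  -- For negative `d_ℓ`: from the event that stage `ℓ - 1` is undecided, the part where stage `ℓ`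
  -- does not reject is removed; that part is again a difference of nested events.
  · have hlow : ∀ q, probNeg ε ρ τ θ ζ α β l
        (q / Real.sqrt ((sampleSize ε ρ τ ζ α β (l - 1) : ℝ) - 1)) =
        ν.real {x | stageStat ε ρ τ γ ζ α β l x ≤ bThr ε ρ τ ζ α β l ∧
          q < stageStat ε ρ τ γ ζ α β (l - 1) x} :=
      fun q => auxLaw_real_lower γ θ hσ hm hmn (not_le.1 hd) q
    have hE : ∀ q, MeasurableSet {x | stageStat ε ρ τ γ ζ α β l x ≤ bThr ε ρ τ ζ α β l ∧
        q < stageStat ε ρ τ γ ζ α β (l - 1) x} := fun q =>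
      (measurableSet_le (hmeas l) measurable_const).inter
        (measurableSet_lt measurable_const (hmeas (l - 1)))
    have hsub : {x | stageStat ε ρ τ γ ζ α β l x ≤ bThr ε ρ τ ζ α β l ∧
          bThr ε ρ τ ζ α β (l - 1) < stageStat ε ρ τ γ ζ α β (l - 1) x} ⊆
        {x | stageStat ε ρ τ γ ζ α β l x ≤ bThr ε ρ τ ζ α β l ∧
          aThr ε ρ τ ζ α β (l - 1) < stageStat ε ρ τ γ ζ α β (l - 1) x} :=
      fun x hx => ⟨hx.1, hab.trans_lt hx.2⟩
    rw [dThr, cThr, hlow, hlow, add_sub_assoc, ← neg_sub, ← measureReal_sdiff hsub (hE _),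
      ← sub_eq_add_neg, ← measureReal_sdiff ?_ ((hE _).diff (hE _))]
    · congr 1
      ext x
      simp only [Set.mem_sdiff, Set.mem_ofPred_eq, not_and, not_lt]
      grind
    · intro x hx
      simp only [Set.mem_sdiff, Set.mem_ofPred_eq, not_and, not_lt] at hx ⊢
      exact ⟨hx.1.2, hx.2 hx.1.1⟩

/-- Lower bound for the probability of acceptance. -/
lemma one_sub_ocBoundSharp_le (hρ : 0 < ρ) (hτ : 1 ≤ τ) (hσ : 0 < σ)
    (hn1 : 2 ≤ sampleSize ε ρ τ ζ α β 1) :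
    1 - ocBoundSharp ε ρ τ γ σ θ ζ α β ≤
      (sampleLaw (θ * σ + γ) σ).real {x | AcceptsH0 ε ρ τ γ ζ α β x} := by
  set ν := sampleLaw (θ * σ + γ) σ with hν
  have hcompl : ν.real {x | AcceptsH0 ε ρ τ γ ζ α β x}ᶜ ≤ ocBoundSharp ε ρ τ γ σ θ ζ α β := by
    have hsub : {x | AcceptsH0 ε ρ τ γ ζ α β x}ᶜ ⊆
        {x | bThr ε ρ τ ζ α β 1 < stageStat ε ρ τ γ ζ α β 1 x} ∪
          ⋃ l ∈ Finset.Icc 2 (numStages ε ρ τ ζ α β), {x |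
            (aThr ε ρ τ ζ α β (l - 1) < stageStat ε ρ τ γ ζ α β (l - 1) x ∧
              stageStat ε ρ τ γ ζ α β (l - 1) x ≤ bThr ε ρ τ ζ α β (l - 1)) ∧
            bThr ε ρ τ ζ α β l < stageStat ε ρ τ γ ζ α β l x} := by
      intro x hx
      rcases exists_reject_of_not_acceptsH0 hρ hτ hn1 hx with h | ⟨l, hl, h⟩
      · exact Or.inl h
      · exact Or.inr (Set.mem_biUnion hl h)
    refine (measureReal_mono hsub).trans ((measureReal_union_le _ _).trans ?_)
    refine add_le_add le_rfl ((measureReal_biUnion_finset_le _ _).trans ?_)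
    exact Finset.sum_le_sum fun l hl => (stageTerm_eq hσ hn1 hl).ge
  have h1 := probReal_compl_eq_one_sub (μ := ν)
    (measurableSet_acceptsH0 (ε := ε) (ρ := ρ) (τ := τ) (ζ := ζ) (α := α) (β := β) (γ := γ))
  linarith

lemma ocBoundSharp_le_ocBound :
    ocBoundSharp ε ρ τ γ σ θ ζ α β ≤ ocBound ε ρ τ γ σ θ ζ α β :=
  add_le_add (measureReal_mono fun _ hx => (aThr_le_bThr 1).trans_lt hx) le_rfl

/-- Reflection of the observations about `γ`. -/
lemma hasLaw_reflect (γ θ : ℝ) (σ : ℝ) :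
    HasLaw (fun (x : ℕ → ℝ) i => 2 * γ - x i) (sampleLaw (-θ * σ + γ) σ)
      (sampleLaw (θ * σ + γ) σ) := by
  have hm : Measurable fun (x : ℕ → ℝ) (i : ℕ) => 2 * γ - x i := by fun_prop
  refine ⟨hm.aemeasurable, ?_⟩
  unfold sampleLaw
  rw [Measure.infinitePi_map_pi (fun _ : ℕ => gaussianReal (θ * σ + γ) (Real.toNNReal (σ ^ 2)))
    (f := fun _ y => 2 * γ - y) (fun _ => by fun_prop)]
  congr 1
  ext1 i
  rw [gaussianReal_map_const_sub]
  congr 1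
  ring

lemma tStat_reflect {n : ℕ} (hn : 1 ≤ n) (γ : ℝ) (x : ℕ → ℝ) :
    tStat γ n (fun i => 2 * γ - x i) = -tStat γ n x := by
  have h : (fun i => 2 * γ - x i) = fun i => (-1) * x i + 2 * γ := by
    ext i
    ring
  rw [h, tStat, sampleMean_affine hn, sampleSD_affine hn, tStat, abs_neg, abs_one, one_mul,
    ← neg_div]
  congr 1
  ring

/-- Up to boundary cases, acceptance is rejection for the reflected test with interchanged error
levels. -/
lemma not_acceptsH0_reflect {x : ℕ → ℝ} (hn1 : 2 ≤ sampleSize ε ρ τ ζ α β 1)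
    (hne : ∀ l, 1 ≤ l → l ≤ numStages ε ρ τ ζ α β →
      stageStat ε ρ τ γ ζ α β l x ≠ aThr ε ρ τ ζ α β l ∧
      stageStat ε ρ τ γ ζ α β l x ≠ bThr ε ρ τ ζ α β l)
    (hx : AcceptsH0 ε ρ τ γ ζ α β x) :
    ¬ AcceptsH0 ε ρ τ γ ζ β α (fun i => 2 * γ - x i) := by
  have hstat : ∀ l, 1 ≤ l → l ≤ numStages ε ρ τ ζ α β →
      stageStat ε ρ τ γ ζ β α l (fun i => 2 * γ - x i) = -stageStat ε ρ τ γ ζ α β l x := by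
    intro l hl hls
    have := two_le_sampleSize hn1 hl hls
    rw [stageStat, sampleSize_comm, tStat_reflect (by omega), stageStat]
  obtain ⟨l, hl, hls, hl1, hl0⟩ := hx
  rintro ⟨k, hk, hks, hk1, hk0⟩
  rw [numStages_comm] at hks
  rw [decision_eq_one_iff] at hl1
  rw [decision_eq_one_iff, hstat k hk hks, aThr_comm, neg_le_neg_iff] at hk1
  -- At the earlier of the two acceptance stages the other test is undecided, which forces equality
  -- with a threshold. At a common stage, `T ≤ a ≤ b ≤ T`.
  rcases lt_trichotomy k l with h | rfl | h
  · have := ((decision_eq_zero_iff _ _).1 (hl0 k hk h)).2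
    exact (hne k hk hks).2 (le_antisymm this hk1)
  · exact (hne k hk hks).1 (le_antisymm hl1 ((aThr_le_bThr k).trans hk1))
  · have := ((decision_eq_zero_iff _ _).1 (hk0 l hl h)).2
    rw [hstat l hl hls, bThr_comm, neg_le_neg_iff] at this
    exact (hne l hl hls).1 (le_antisymm hl1 this)

/-- Upper bound for the probability of acceptance. -/
lemma acceptsH0_le_ocBoundSharp (hρ : 0 < ρ) (hτ : 1 ≤ τ) (hσ : 0 < σ)
    (hn1 : 2 ≤ sampleSize ε ρ τ ζ α β 1) :
    (sampleLaw (θ * σ + γ) σ).real {x | AcceptsH0 ε ρ τ γ ζ α β x} ≤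
      ocBoundSharp ε ρ τ γ σ (-θ) ζ β α := by
  -- The reflected sample has parameter `-θ`, so the lower bound applies to it with the error levels
  -- interchanged.
  have hlow := one_sub_ocBoundSharp_le (γ := γ) (θ := -θ) hρ hτ hσ
    (hn1.trans_eq (sampleSize_comm 1))
  have hmeas := measurableSet_acceptsH0 (ε := ε) (ρ := ρ) (τ := τ) (ζ := ζ) (α := β) (β := α)
    (γ := γ)
  rw [← (hasLaw_reflect γ θ σ).measureReal_eq hmeas] at hlow
  set ν := sampleLaw (θ * σ + γ) σ with hν
  have hmeas' : MeasurableSet {x : ℕ → ℝ | AcceptsH0 ε ρ τ γ ζ β α fun i => 2 * γ - x i} :=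
    hmeas.preimage (f := fun (x : ℕ → ℝ) i => 2 * γ - x i) (by fun_prop)
  have hle : ν.real {x | AcceptsH0 ε ρ τ γ ζ α β x} ≤
      ν.real {x : ℕ → ℝ | AcceptsH0 ε ρ τ γ ζ β α fun i => 2 * γ - x i}ᶜ := by
    refine ENNReal.toReal_mono (measure_ne_top _ _) (measure_mono_ae ?_)
    have hne : ∀ᵐ x ∂ν, ∀ l, 1 ≤ l → l ≤ numStages ε ρ τ ζ α β →
        stageStat ε ρ τ γ ζ α β l x ≠ aThr ε ρ τ ζ α β l ∧
        stageStat ε ρ τ γ ζ α β l x ≠ bThr ε ρ τ ζ α β l := by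
      refine ae_all_iff.2 fun l => ?_
      by_cases hl : 1 ≤ l ∧ l ≤ numStages ε ρ τ ζ α β
      · have h2 := two_le_sampleSize hn1 hl.1 hl.2
        filter_upwards [tStat_ne γ θ hσ h2 (aThr ε ρ τ ζ α β l),
          tStat_ne γ θ hσ h2 (bThr ε ρ τ ζ α β l)] with x ha hb _ _
        exact ⟨ha, hb⟩
      · exact Filter.Eventually.of_forall fun x h1 h2 => absurd ⟨h1, h2⟩ hl
    filter_upwards [hne] with x hx hacc
    exact not_acceptsH0_reflect hn1 hx hacc
  rw [probReal_compl_eq_one_sub hmeas'] at hle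
  linarith

end Design

end TTest

end
theorem theorem4 {Ω : Type*} [MeasurableSpace Ω] (P : Measure Ω) [IsProbabilityMeasure P]
    (X : ℕ → Ω → ℝ)
    (ε ρ : ℝ) (τ : ℕ) (γ σ ζ α β θ : ℝ)
    (hε : 0 < ε) (hρ : 0 < ρ) (hτ : 1 ≤ τ) (hσ : 0 < σ) (hζ : 0 < ζ)
    (hα : 0 < α) (hα1 : α < 1) (hβ : 0 < β) (hβ1 : β < 1)
    (hζα : ζ * α < 1) (hζβ : ζ * β < 1)
    (hn1 : 2 ≤ TTest.sampleSize ε ρ τ ζ α β 1)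
    (hindep : iIndepFun X P)
    (hlaw : ∀ i, HasLaw (X i) (gaussianReal (θ * σ + γ) (Real.toNNReal (σ ^ 2))) P) :
    (θ ≤ -ε →
      1 - TTest.ocBound ε ρ τ γ σ θ ζ α β ≤
          P.real {ω | TTest.AcceptsH0 ε ρ τ γ ζ α β (fun i => X i ω)} ∧
      1 - TTest.ocBoundSharp ε ρ τ γ σ θ ζ α β ≤
          P.real {ω | TTest.AcceptsH0 ε ρ τ γ ζ α β (fun i => X i ω)}) ∧
    (ε ≤ θ →
      P.real {ω | TTest.AcceptsH0 ε ρ τ γ ζ α β (fun i => X i ω)} ≤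
          TTest.ocBound ε ρ τ γ σ (-θ) ζ β α ∧
      P.real {ω | TTest.AcceptsH0 ε ρ τ γ ζ α β (fun i => X i ω)} ≤
          TTest.ocBoundSharp ε ρ τ γ σ (-θ) ζ β α) := by
  -- Acceptance depends only on the law of the whole sequence, so the problem moves to the canonical
  -- product space.
  have hX : HasLaw (fun ω i => X i ω) (TTest.sampleLaw (θ * σ + γ) σ) P :=
    hindep.hasLaw_infinitePi hlaw (aemeasurable_pi_iff.2 fun i => (hlaw i).aemeasurable)
  rw [hX.measureReal_eq TTest.measurableSet_acceptsH0]
  have hlow := TTest.one_sub_ocBoundSharp_le (γ := γ) (θ := θ) hρ hτ hσ hn1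
  have hup := TTest.acceptsH0_le_ocBoundSharp (γ := γ) (θ := θ) hρ hτ hσ hn1
  have h1 : TTest.ocBoundSharp ε ρ τ γ σ θ ζ α β ≤ TTest.ocBound ε ρ τ γ σ θ ζ α β :=
    TTest.ocBoundSharp_le_ocBound
  have h2 : TTest.ocBoundSharp ε ρ τ γ σ (-θ) ζ β α ≤ TTest.ocBound ε ρ τ γ σ (-θ) ζ β α :=
    TTest.ocBoundSharp_le_ocBound
  exact ⟨fun _ => ⟨by linarith, hlow⟩, fun _ => ⟨hup.trans h2, hup⟩⟩
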